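/- There are a universal constant $C$ and a single decoding function $D$, which maps two labels to a number in $[0,\infty]$, such that the following holds. Here a label is a finite sequence of words, and the size of a label is the number of its words; in a labeling of a weighted graph on $n$ vertices, each word is either a vertex name from $\{0,\dots,n-1\}$ or the value $d_G(u,v)$ of the distance between two vertices. Let $G=(V,E)$ be an undirected graph with $n$ vertices and nonnegative real edge weights, let $d_G$ be its shortest-path distance ($\infty$ between different components), and let $x_1,\dots,x_n$ be an arbitrary ordering (priority ranking) of $V$. Then for every real $t\ge 1$ the vertices can be given labels $L(v)$ such that (1) (prioritized stretch) for all $1\le j<i\le n$, the value $\tilde d=D(L(x_j),L(x_i))$ satisfies $$d_G(x_j,x_i)\le \tilde d\le \alpha(j)\, d_G(x_j,x_i),\qquad \alpha(j)=\max\Big\{1,\;2\Big\lceil \frac{t\log j}{\log n}\Big\rceil-1\Big\},$$ and the same holds for $\tilde d=D(L(x_i),L(x_j))$ (the maximum with $1$ matters only for $j=1$, where the distances are exact); (2) (prioritized label size) for every $1\le j\le n$, the label $L(x_j)$ has at most $C\cdot n^{1/t}\cdot\max\{1,\log_2 j\}$ words. In particular (the case $t=\log_2 n$), every such graph and ordering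 admit labels, decoded by the same $D$, with prioritized stretch $\max\{1,2\lceil\log_2 j\rceil-1\}$ in the sense of (1) and with at most $C\cdot\max\{1,\log_2 j\}$ words in the label of $x_j$ for every $1\le j\le n$. -/

import Mathlib

open scoped ENNReal NNReal

universe u

namespace PrioritizedLabeling

/-- The shortest-path distance of the graph `G` with edge weights `w`: the infimum over all walks
from `u` to `v` of the total weight of the walk (and `∞` if there is no walk). Only the weights of
edges of `G` matter. -/
noncomputable def graphDist {V : Type*} (G : SimpleGraph V) (w : Sym2 V → ℝ≥0) (u v : V) : ℝ≥0∞ :=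
  ⨅ p : G.Walk u v, (((p.edges.map w).sum : ℝ≥0) : ℝ≥0∞)

/-- A machine word of a label. It holds either the name of a vertex, which is a number, or the
value of a distance. -/
inductive Word where
  | name (k : ℕ) : Word
  | dist (r : ℝ≥0∞) : Word

/-- A label is a finite sequence of words; its size is the number of words, `List.length`. -/
abbrev Label := List Word

/-- The words that labels of an `n`-vertex weighted graph may use: a name is a number below `n`,
and a distance is the distance in the graph between two vertices. In particular, if the distances
are integers that are polynomially bounded in `n`, then each word is an `O(log n)`-bit string. -/
def Word.Admissible {V : Type*} (n : ℕ) (G : SimpleGraph V) (w : Sym2 V → ℝ≥0) : Word → Prop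
  | Word.name k => k < n
  | Word.dist r => ∃ u v : V, r = graphDist G w u v

/-- `L` assigns to every vertex a label made of admissible words. -/
def IsLabeling {V : Type*} (n : ℕ) (G : SimpleGraph V) (w : Sym2 V → ℝ≥0) (L : V → Label) : Prop :=
  ∀ v : V, ∀ a ∈ L v, a.Admissible n G w

/-- Prioritized stretch `α` with respect to the ranking `x`: for all ranks `j < i`, the answer `D`
computes from the two labels of `x_j` and `x_i` alone (given in either order) is at least the
distance and at most `α j` times the distance. The vertex `x j` has rank `j + 1`,
since `Fin n` starts at `0`. -/
def HasPrioritizedStretch {V : Type*} {n : ℕ} (G : SimpleGraph V) (w : Sym2 V → ℝ≥0)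
    (x : Fin n ≃ V) (D : Label → Label → ℝ≥0∞) (L : V → Label) (α : ℕ → ℝ) : Prop :=
  ∀ j i : Fin n, j < i →
    (graphDist G w (x j) (x i) ≤ D (L (x j)) (L (x i)) ∧
      D (L (x j)) (L (x i)) ≤ ENNReal.ofReal (α (j + 1)) * graphDist G w (x j) (x i)) ∧
    (graphDist G w (x j) (x i) ≤ D (L (x i)) (L (x j)) ∧
      D (L (x i)) (L (x j)) ≤ ENNReal.ofReal (α (j + 1)) * graphDist G w (x j) (x i))

/-- Prioritized label size `β` with respect to the ranking `x`: the label of the vertex of rank `j`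
has at most `β j` words. -/
def HasPrioritizedLabelSize {V : Type*} {n : ℕ} (x : Fin n ≃ V) (L : V → Label) (β : ℕ → ℝ) :
    Prop :=
  ∀ j : Fin n, ((L (x j)).length : ℝ) ≤ β (j + 1)

end PrioritizedLabeling

/-!
The labels are hub labels. The label of `v` lists pairs `(h, d(v, h))` for the hubs `h` in a finite
set, and the decoder returns the smallest `d(u, h) + d(h, v)` over the common hubs `h` of the two
labels. By the triangle inequality the answer never underestimates the distance, so everything
depends on a choice of hubs (`exists_hubs`).

Put `m = n ^ (1 / t)`; one may assume `m ≥ 2`, since a larger `m` only improves the stretch. The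
hubs come from a Thorup–Zwick hierarchy of vertex sets `A 0, A 1, …, A T = V`, in which `A l` is
forced to contain all vertices of rank at most `m ^ (l + 1)`. A vertex of rank `j` uses only the
levels up to `κ = max 1 ⌈log_m j⌉ - 1`: its hubs are itself, all of `A 0` and, for each `l < κ`, a
nearest point in `A l` and its bunch, the points of `A (l + 1)` strictly closer to it than `A l`.
As the vertex of rank `j` is itself in `A κ`, the usual ping-pong argument for it and a vertex of
larger rank may begin at level `κ`, and it yields stretch `2 κ + 1` (`exists_common_hub`).

For the sizes, `A l` consists of the forced vertices and of a random sample of `A (l + 1)` with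
probability `p = 1 / (2 m)`. The factor `2` keeps the expected size of `A 0` at most `2 m`, despite
the vertices added at each level. The number `X` of points of a bunch is dominated by a geometric
variable, so `(1 + p / 2) ^ X` has mean at most `2` (`bernoulliMean_bunch_le`). Independence
between the levels turns this into a bound for the total bunch size of the vertex of rank `j`, which
exceeds `O(m log j)` with probability `O(j ^ (-2))`; these probabilities are summable over `j`, and
so no factor `log n` is lost. Here the random choice is made one level at a time, by keeping a
potential, namely the weighted sum of these exponential moments and of `|A 0|`, from increasing
(`exists_hierarchy`).
-/

namespace PrioritizedLabeling

/-! ### Shortest-path distance -/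

section GraphDist

variable {V : Type*} (G : SimpleGraph V) (w : Sym2 V → ℝ≥0)

lemma graphDist_self (u : V) : graphDist G w u u = 0 := by
  refine le_antisymm ?_ bot_le
  exact (iInf_le _ SimpleGraph.Walk.nil).trans (by simp)

lemma graphDist_comm (u v : V) : graphDist G w u v = graphDist G w v u := by
  have key : ∀ a b : V, graphDist G w a b ≤ graphDist G w b a := fun a b =>
    le_iInf fun p => (iInf_le _ p.reverse).trans (by simp)
  exact le_antisymm (key u v) (key v u)

lemma graphDist_triangle (u v z : V) :
    graphDist G w u z ≤ graphDist G w u v + graphDist G w v z := by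
  unfold graphDist
  rw [ENNReal.iInf_add]
  refine le_iInf fun p => ?_
  rw [ENNReal.add_iInf]
  refine le_iInf fun q => (iInf_le _ (p.append q)).trans ?_
  simp

end GraphDist

/-! ### Encoding hub sets as labels -/

/-- The list of words that spells out a list of hubs, each with its distance. -/
def encodeHubs : List (ℕ × ℝ≥0∞) → Label
  | [] => []
  | (k, r) :: l => Word.name k :: Word.dist r :: encodeHubs l

/-- The list of hubs with distances read off from a label; it ends where the label ceases to
alternate between names and distances. -/
def decodeHubs : Label → List (ℕ × ℝ≥0∞)
  | Word.name k :: Word.dist r :: l => (k, r) :: decodeHubs l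
  | _ => []

lemma decodeHubs_encodeHubs (l : List (ℕ × ℝ≥0∞)) : decodeHubs (encodeHubs l) = l := by
  induction l with
  | nil => rfl
  | cons a l ih => simp [encodeHubs, decodeHubs, ih]

lemma length_encodeHubs (l : List (ℕ × ℝ≥0∞)) : (encodeHubs l).length = 2 * l.length := by
  induction l with
  | nil => rfl
  | cons a l ih => simp [encodeHubs, ih]; ring

lemma mem_encodeHubs {l : List (ℕ × ℝ≥0∞)} {a : Word} (h : a ∈ encodeHubs l) :
    ∃ e ∈ l, a = Word.name e.1 ∨ a = Word.dist e.2 := by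
  induction l with
  | nil => simp [encodeHubs] at h
  | cons b l ih =>
    simp only [encodeHubs, List.mem_cons] at h
    rcases h with h | h | h
    · exact ⟨b, by simp, Or.inl h⟩
    · exact ⟨b, by simp, Or.inr h⟩
    · obtain ⟨e, he, h⟩ := ih h
      exact ⟨e, by simp [he], h⟩

/-- The decoder: the length of a shortest detour through a common hub of the two labels. -/
noncomputable def hubDist (L₁ L₂ : Label) : ℝ≥0∞ :=
  ⨅ (k : ℕ) (r₁ : ℝ≥0∞) (r₂ : ℝ≥0∞) (_ : (k, r₁) ∈ decodeHubs L₁) (_ : (k, r₂) ∈ decodeHubs L₂),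
    r₁ + r₂

lemma hubDist_le {L₁ L₂ : Label} {k : ℕ} {r₁ r₂ : ℝ≥0∞} (h₁ : (k, r₁) ∈ decodeHubs L₁)
    (h₂ : (k, r₂) ∈ decodeHubs L₂) : hubDist L₁ L₂ ≤ r₁ + r₂ :=
  iInf_le_of_le k <| iInf_le_of_le r₁ <| iInf_le_of_le r₂ <| iInf_le_of_le h₁ <|
    iInf_le_of_le h₂ le_rfl

lemma le_hubDist {L₁ L₂ : Label} {b : ℝ≥0∞}
    (h : ∀ k r₁ r₂, (k, r₁) ∈ decodeHubs L₁ → (k, r₂) ∈ decodeHubs L₂ → b ≤ r₁ + r₂) :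
    b ≤ hubDist L₁ L₂ :=
  le_iInf fun k => le_iInf fun r₁ => le_iInf fun r₂ => le_iInf fun h₁ => le_iInf fun h₂ =>
    h k r₁ r₂ h₁ h₂

/-! ### Averages over random subsets -/

section Sampling

open Finset

variable {ι : Type*}

/-- The mean of `f R` when `R` is a random subset of `A` that contains each element of `A`
independently with probability `p`. -/
noncomputable def bernoulliMean (p : ℝ) (A : Finset ι) (f : Finset ι → ℝ) : ℝ :=
  ∑ R ∈ A.powerset, p ^ #R * (1 - p) ^ (#A - #R) * f R

lemma bernoulliMean_empty (p : ℝ) (f : Finset ι → ℝ) : bernoulliMean p ∅ f = f ∅ := by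
  simp [bernoulliMean]

lemma bernoulliMean_insert [DecidableEq ι] (p : ℝ) {A : Finset ι} {a : ι} (ha : a ∉ A)
    (f : Finset ι → ℝ) :
    bernoulliMean p (insert a A) f =
      (1 - p) * bernoulliMean p A f + p * bernoulliMean p A (fun R => f (insert a R)) := by
  unfold bernoulliMean
  rw [Finset.sum_powerset_insert ha, Finset.mul_sum, Finset.mul_sum]
  congr 1
  · refine Finset.sum_congr rfl fun R hR => ?_
    have hc := Finset.card_le_card (Finset.mem_powerset.1 hR)
    rw [Finset.card_insert_of_notMem ha, Nat.sub_add_comm hc, pow_succ]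
    ring
  · refine Finset.sum_congr rfl fun R hR => ?_
    have haR : a ∉ R := fun h => ha (Finset.mem_powerset.1 hR h)
    rw [Finset.card_insert_of_notMem ha, Finset.card_insert_of_notMem haR, Nat.add_sub_add_right,
      pow_succ]
    ring

lemma bernoulliMean_const [DecidableEq ι] (p : ℝ) (A : Finset ι) (c : ℝ) :
    bernoulliMean p A (fun _ => c) = c := by
  induction A using Finset.induction_on with
  | empty => exact bernoulliMean_empty p _
  | insert a A ha ih => rw [bernoulliMean_insert p ha, ih]; ring

lemma bernoulliMean_add (p : ℝ) (A : Finset ι) (f g : Finset ι → ℝ) :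
    bernoulliMean p A (fun R => f R + g R) = bernoulliMean p A f + bernoulliMean p A g := by
  simp only [bernoulliMean, mul_add, Finset.sum_add_distrib]

lemma bernoulliMean_mul_left (p : ℝ) (A : Finset ι) (c : ℝ) (f : Finset ι → ℝ) :
    bernoulliMean p A (fun R => c * f R) = c * bernoulliMean p A f := by
  simp only [bernoulliMean, Finset.mul_sum]
  exact Finset.sum_congr rfl fun R _ => by ring

lemma bernoulliMean_sum {κ : Type*} (p : ℝ) (A : Finset ι) (s : Finset κ)
    (f : κ → Finset ι → ℝ) :
    bernoulliMean p A (fun R => ∑ j ∈ s, f j R) = ∑ j ∈ s, bernoulliMean p A (f j) := by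
  simp only [bernoulliMean, Finset.mul_sum]
  exact Finset.sum_comm

lemma bernoulliMean_mono {p : ℝ} (hp0 : 0 ≤ p) (hp1 : p ≤ 1) {A : Finset ι}
    {f g : Finset ι → ℝ} (h : ∀ R ⊆ A, f R ≤ g R) : bernoulliMean p A f ≤ bernoulliMean p A g := by
  have : 0 ≤ 1 - p := by linarith
  exact Finset.sum_le_sum fun R hR =>
    mul_le_mul_of_nonneg_left (h R (Finset.mem_powerset.1 hR)) (by positivity)

lemma bernoulliMean_card [DecidableEq ι] (p : ℝ) (A : Finset ι) :
    bernoulliMean p A (fun R => (#R : ℝ)) = p * #A := by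
  induction A using Finset.induction_on with
  | empty => simp [bernoulliMean_empty]
  | insert a A ha ih =>
    have h : bernoulliMean p A (fun R => (#(insert a R) : ℝ)) =
        bernoulliMean p A (fun R => (#R : ℝ) + 1) := by
      refine Finset.sum_congr rfl fun R hR => ?_
      have haR : a ∉ R := fun h => ha (Finset.mem_powerset.1 hR h)
      simp only [Finset.card_insert_of_notMem haR]
      push_cast; ring
    rw [bernoulliMean_insert p ha, h, bernoulliMean_add, ih, bernoulliMean_const,
      Finset.card_insert_of_notMem ha]
    push_cast; ring

lemma exists_le_bernoulliMean [DecidableEq ι] {p : ℝ} (hp0 : 0 ≤ p) (hp1 : p ≤ 1) (A : Finset ι)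
    (f : Finset ι → ℝ) : ∃ R ⊆ A, f R ≤ bernoulliMean p A f := by
  obtain ⟨R, hR, hmin⟩ := A.powerset.exists_min_image f ⟨∅, Finset.empty_mem_powerset A⟩
  refine ⟨R, Finset.mem_powerset.1 hR, ?_⟩
  rw [← bernoulliMean_const p A (f R)]
  exact bernoulliMean_mono hp0 hp1 fun R' hR' => hmin R' (Finset.mem_powerset.2 hR')

/-! ### Bunches and the hierarchy -/

variable (d : ι → ι → ℝ≥0∞)

open Classical in
/-- The bunch of `v`: the points of `A` that are strictly closer to `v` than every point of `B`. -/
noncomputable def bunch (A B : Finset ι) (v : ι) : Finset ι :=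
  A.filter fun a => ∀ b ∈ B, d v a < d v b

lemma mem_bunch {A B : Finset ι} {v a : ι} :
    a ∈ bunch d A B v ↔ a ∈ A ∧ ∀ b ∈ B, d v a < d v b := by
  simp [bunch]

lemma bunch_anti {A B B' : Finset ι} (h : B ⊆ B') (v : ι) : bunch d A B' v ⊆ bunch d A B v :=
  fun a ha => by
    rw [mem_bunch] at ha ⊢
    exact ⟨ha.1, fun b hb => ha.2 b (h hb)⟩

/-- The size of a bunch with respect to a random sample is dominated by a geometric variable: one
runs through `A` in the order of the distance from `v`, and stops at the first sampled point. -/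
lemma bernoulliMean_bunch_le [DecidableEq ι] {p : ℝ} (hp0 : 0 ≤ p) (hp1 : p ≤ 1) (A : Finset ι)
    (v : ι) : bernoulliMean p A (fun R => (1 + p / 2) ^ #(bunch d A R v)) ≤ 2 := by
  induction A using Finset.induction_on_min_value (d v) with
  | empty => simp [bernoulliMean_empty, bunch]
  | insert a A ha hmin ih =>
    have h1 : bernoulliMean p A (fun R => (1 + p / 2) ^ #(bunch d (insert a A) R v)) ≤
        (1 + p / 2) * 2 := by
      refine le_trans ?_ (mul_le_mul_of_nonneg_left ih (by positivity))
      rw [← bernoulliMean_mul_left]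
      refine bernoulliMean_mono hp0 hp1 fun R _ => ?_
      rw [← pow_succ']
      refine pow_le_pow_right₀ (by linarith) ?_
      refine (Finset.card_le_card (t := insert a (bunch d A R v)) fun b hb => ?_).trans
        (Finset.card_insert_le _ _)
      rw [mem_bunch, Finset.mem_insert] at hb
      rw [Finset.mem_insert, mem_bunch]
      tauto
    -- If the nearest point `a` is sampled, then the bunch is empty.
    have h2 : bernoulliMean p A (fun R => (1 + p / 2) ^ #(bunch d (insert a A) (insert a R) v)) ≤
        1 := by
      rw [← bernoulliMean_const p A 1]
      refine bernoulliMean_mono hp0 hp1 fun R _ => le_of_eq ?_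
      have : bunch d (insert a A) (insert a R) v = ∅ := by
        refine Finset.eq_empty_of_forall_notMem fun b hb => ?_
        rw [mem_bunch, Finset.mem_insert] at hb
        have hlt := hb.2 a (Finset.mem_insert_self a R)
        rcases hb.1 with rfl | hbA
        · exact lt_irrefl _ hlt
        · exact absurd hlt (not_lt.2 (hmin b hbA))
      simp [this]
    rw [bernoulliMean_insert p ha]
    have h3 := mul_le_mul_of_nonneg_left h1 (sub_nonneg.2 hp1)
    have h4 := mul_le_mul_of_nonneg_left h2 hp0
    nlinarith [mul_nonneg hp0 hp0]

open Classical in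
/-- The factor by which the potential of `v` changes at a level: the exponential moment of the size
of the bunch of `v`, normalized to have mean at most `1`, if `v` uses that level (`P`). -/
noncomputable def bunchFactor (p : ℝ) (P : Prop) (A B : Finset ι) (v : ι) : ℝ :=
  if P then (1 + p / 2) ^ #(bunch d A B v) / 2 else 1

lemma bunchFactor_nonneg {p : ℝ} (hp0 : 0 ≤ p) (P : Prop) (A B : Finset ι) (v : ι) :
    0 ≤ bunchFactor d p P A B v := by
  unfold bunchFactor; split_ifs <;> positivity

lemma bunchFactor_anti {p : ℝ} (hp0 : 0 ≤ p) (P : Prop) {A B B' : Finset ι} (h : B ⊆ B') (v : ι) :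
    bunchFactor d p P A B' v ≤ bunchFactor d p P A B v := by
  unfold bunchFactor
  split_ifs
  · have : (1 : ℝ) ≤ 1 + p / 2 := by linarith
    gcongr
    exact bunch_anti d h v
  · exact le_rfl

lemma bernoulliMean_bunchFactor_le [DecidableEq ι] {p : ℝ} (hp0 : 0 ≤ p) (hp1 : p ≤ 1) (P : Prop)
    (A : Finset ι) (v : ι) : bernoulliMean p A (fun R => bunchFactor d p P A R v) ≤ 1 := by
  by_cases hP : P
  · simp only [bunchFactor, if_pos hP, div_eq_inv_mul]
    rw [bernoulliMean_mul_left]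
    have := bernoulliMean_bunch_le d hp0 hp1 A v
    simp only [div_eq_inv_mul] at this
    linarith
  · simp only [bunchFactor, if_neg hP]
    rw [bernoulliMean_const]

/-- One level of the hierarchy: there is a sample that keeps the potential at most its mean. -/
lemma exists_sample [DecidableEq ι] [Fintype ι] {p : ℝ} (hp0 : 0 ≤ p) (hp1 : p ≤ 1)
    (P : ι → Prop) (φ : ι → ℝ) (hφ : ∀ v, 0 ≤ φ v) (c : ℝ) (A S : Finset ι) (hc : 0 ≤ c) :
    ∃ B : Finset ι, S ⊆ B ∧
      ∑ v, φ v * bunchFactor d p (P v) A B v + c * #B ≤ ∑ v, φ v + c * (p * #A + #S) := by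
  obtain ⟨R, -, hR⟩ := exists_le_bernoulliMean hp0 hp1 A
    (fun R => ∑ v, φ v * bunchFactor d p (P v) A R v + c * #R)
  refine ⟨S ∪ R, Finset.subset_union_left, ?_⟩
  rw [bernoulliMean_add, bernoulliMean_sum, bernoulliMean_mul_left, bernoulliMean_card] at hR
  have h1 : ∑ v, bernoulliMean p A (fun R => φ v * bunchFactor d p (P v) A R v) ≤ ∑ v, φ v := by
    refine Finset.sum_le_sum fun v _ => ?_
    rw [bernoulliMean_mul_left]
    exact mul_le_of_le_one_right (hφ v) (bernoulliMean_bunchFactor_le d hp0 hp1 _ A v)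
  have h2 : ∑ v, φ v * bunchFactor d p (P v) A (S ∪ R) v ≤
      ∑ v, φ v * bunchFactor d p (P v) A R v :=
    Finset.sum_le_sum fun v _ => mul_le_mul_of_nonneg_left
      (bunchFactor_anti d hp0 _ Finset.subset_union_right v) (hφ v)
  have h3 : (#(S ∪ R) : ℝ) ≤ #S + #R := by exact_mod_cast Finset.card_union_le S R
  have h4 := mul_le_mul_of_nonneg_left h3 hc
  linarith

/-- The whole hierarchy below a given set `A` at level `T`, by descent through the levels. The
vertex `v` uses the bunches at the levels up to `κ v`, and `S l` is forced into level `l`. -/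
lemma exists_hierarchy [DecidableEq ι] [Fintype ι] {p : ℝ} (hp0 : 0 ≤ p) (hp1 : p ≤ 1)
    (κ : ι → ℕ) (S : ℕ → Finset ι) {c : ℝ} (hc : 0 ≤ c) (T : ℕ) :
    ∀ (A : Finset ι) (φ : ι → ℝ), (∀ v, 0 ≤ φ v) →
      ∃ F : ℕ → Finset ι, F T = A ∧ (∀ l < T, S l ⊆ F l) ∧
        ∑ v, φ v * ∏ l ∈ range T, bunchFactor d p (l < κ v) (F (l + 1)) (F l) v + c * #(F 0) ≤
          ∑ v, φ v + c * (p ^ T * #A + ∑ l ∈ range T, p ^ l * #(S l)) := by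
  induction T with
  | zero => intro A φ _; exact ⟨fun _ => A, rfl, by simp, by simp⟩
  | succ T ih =>
    intro A φ hφ
    obtain ⟨B, hSB, hB⟩ := exists_sample d hp0 hp1 (fun v => T < κ v) φ hφ (c * p ^ T) A (S T)
      (by positivity)
    obtain ⟨F, hFT, hSF, hF⟩ := ih B (fun v => φ v * bunchFactor d p (T < κ v) A B v)
      fun v => mul_nonneg (hφ v) (bunchFactor_nonneg d hp0 _ _ _ v)
    have hlow : ∀ l ≤ T, Function.update F (T + 1) A l = F l := fun l hl =>
      Function.update_of_ne (by omega) _ _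
    refine ⟨Function.update F (T + 1) A, by simp, fun l hl => ?_, ?_⟩
    · rw [hlow l (by omega)]
      rcases Nat.lt_succ_iff_lt_or_eq.1 hl with h | rfl
      · exact hSF l h
      · rw [hFT]; exact hSB
    · have hprod : ∀ v, ∏ l ∈ range (T + 1), bunchFactor d p (l < κ v)
          (Function.update F (T + 1) A (l + 1)) (Function.update F (T + 1) A l) v =
          bunchFactor d p (T < κ v) A B v *
            ∏ l ∈ range T, bunchFactor d p (l < κ v) (F (l + 1)) (F l) v := by
        intro v
        rw [Finset.prod_range_succ, hlow T le_rfl, hFT, Function.update_self, mul_comm]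
        congr 1
        refine Finset.prod_congr rfl fun l hl => ?_
        have := Finset.mem_range.1 hl
        rw [hlow l (by omega), hlow (l + 1) (by omega)]
      simp only [hprod, ← mul_assoc, hlow 0 (Nat.zero_le T)]
      rw [Finset.sum_range_succ, pow_succ]
      linarith

/-! ### Stretch of the hub sets -/

/-- The ping-pong argument. From `a ∈ F l`, a hub of `u`, one moves to the point of `F (l - 1)`
nearest to `v` with `u` and `v` exchanged, unless `a` is a hub of `v`; each move costs one more
`d u v`. -/
lemma exists_common_hub (hsymm : ∀ a b, d a b = d b a)
    (htri : ∀ a b c, d a c ≤ d a b + d b c) (F : ℕ → Finset ι) (H : ι → Finset ι) (l : ℕ) :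
    ∀ (e : ℕ) (u v a : ι),
      (∀ y ∈ ({u, v} : Set ι), F 0 ⊆ H y ∧ (∀ k < l, bunch d (F (k + 1)) (F k) y ⊆ H y) ∧
        ∀ k < l, ∃ b ∈ F k, b ∈ H y ∧ ∀ b' ∈ F k, d y b ≤ d y b') →
      a ∈ F l → a ∈ H u → d u a ≤ e * d u v →
      ∃ h ∈ H u, h ∈ H v ∧ d u h + d h v ≤ (2 * (l + e) + 1 : ℕ) * d u v := by
  have estimate : ∀ (e k : ℕ) (u v a : ι), e ≤ k → d u a ≤ e * d u v →
      d u a + d a v ≤ (2 * k + 1 : ℕ) * d u v := by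
    intro e k u v a hek hua
    have h1 : d a v ≤ e * d u v + d u v :=
      (htri a u v).trans (add_le_add_left (by rw [hsymm a u]; exact hua) _)
    calc d u a + d a v ≤ e * d u v + (e * d u v + d u v) := add_le_add hua h1
      _ = (2 * e + 1 : ℕ) * d u v := by push_cast; ring
      _ ≤ (2 * k + 1 : ℕ) * d u v := by gcongr
  induction l with
  | zero =>
    intro e u v a hH haF haH hua
    exact ⟨a, haH, (hH v (by simp)).1 haF, estimate e _ u v a (by omega) hua⟩
  | succ l ih =>
    intro e u v a hH haF haH hua
    obtain ⟨hv0, hvB, hvP⟩ := hH v (by simp)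
    by_cases hav : a ∈ bunch d (F (l + 1)) (F l) v
    · exact ⟨a, haH, hvB l (by omega) hav, estimate e _ u v a (by omega) hua⟩
    · obtain ⟨b, hbF, hbH, hb⟩ := hvP l (by omega)
      have : ∃ b' ∈ F l, d v b' ≤ d v a := by
        rw [mem_bunch] at hav
        push Not at hav
        exact hav haF
      obtain ⟨b', hb'F, hb'⟩ := this
      have hvb : d v b ≤ (e + 1 : ℕ) * d v u := by
        calc d v b ≤ d v a := (hb b' hb'F).trans hb'
          _ ≤ d v u + d u a := htri v u a
          _ ≤ d v u + e * d u v := by gcongr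
          _ = (e + 1 : ℕ) * d v u := by rw [hsymm u v]; push_cast; ring
      obtain ⟨h, hhv, hhu, hle⟩ := ih (e + 1) v u b (fun y hy => by
        obtain ⟨h0, h1, h2⟩ := hH y (by rwa [Set.pair_comm])
        exact ⟨h0, fun k hk => h1 k (by omega), fun k hk => h2 k (by omega)⟩) hbF hbH hvb
      refine ⟨h, hhu, hhv, ?_⟩
      rw [hsymm u h, hsymm h v, hsymm u v, add_comm (d h u), show l + 1 + e = l + (e + 1) by omega]
      exact hle

end Sampling

/-! ### Sizes of the hub sets -/

section Hubs

open Finset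

lemma sum_one_div_succ_sq_le (n : ℕ) : ∑ j : Fin n, 1 / ((j : ℝ) + 1) ^ 2 ≤ 2 := by
  have key : ∀ k : ℕ, ∑ j ∈ range (k + 1), 1 / ((j : ℝ) + 1) ^ 2 ≤ 2 - 1 / ((k : ℝ) + 1) := by
    intro k
    induction k with
    | zero => norm_num
    | succ k ih =>
      rw [Finset.sum_range_succ]
      have hstep : 1 / ((k : ℝ) + 1) - 1 / ((k : ℝ) + 1 + 1) - 1 / ((k : ℝ) + 1 + 1) ^ 2 =
          1 / (((k : ℝ) + 1) * ((k : ℝ) + 1 + 1) ^ 2) := by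
        field_simp; ring
      have hpos : 0 ≤ 1 / (((k : ℝ) + 1) * ((k : ℝ) + 1 + 1) ^ 2) := by positivity
      push_cast
      linarith
  rw [Fin.sum_univ_eq_sum_range (fun j => 1 / ((j : ℝ) + 1) ^ 2)]
  have h1 := key n
  have h2 : 0 ≤ 1 / ((n : ℝ) + 1) := by positivity
  have h3 : 0 ≤ 1 / ((n : ℝ) + 1) ^ 2 := by positivity
  rw [Finset.sum_range_succ] at h1
  linarith

/-- The last level used by the vertex of rank `j + 1`. The truncated subtraction sends rank `1`,
whose logarithm is `0`, to level `0`. -/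
noncomputable def lastLevel (m : ℝ) (j : ℕ) : ℕ := ⌈Real.logb m (j + 1 : ℕ)⌉₊ - 1

variable {m : ℝ}

lemma lastLevel_mono (hm : 2 ≤ m) {j i : ℕ} (h : j ≤ i) : lastLevel m j ≤ lastLevel m i := by
  unfold lastLevel
  gcongr
  linarith

lemma succ_le_pow_lastLevel (hm : 2 ≤ m) (j : ℕ) :
    ((j : ℝ) + 1) ≤ m ^ (lastLevel m j + 1) := by
  have h : Real.logb m (j + 1 : ℕ) ≤ (lastLevel m j + 1 : ℕ) :=
    (Nat.le_ceil _).trans (Nat.cast_le.2 (by unfold lastLevel; omega))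
  rw [Real.logb_le_iff_le_rpow (by linarith) (by positivity), Real.rpow_natCast] at h
  exact_mod_cast h

lemma lastLevel_le_logb (hm : 2 ≤ m) (j : ℕ) :
    (lastLevel m j : ℝ) ≤ Real.logb 2 (j + 1 : ℕ) := by
  have h1 : (1 : ℝ) ≤ (j + 1 : ℕ) := by push_cast; linarith [Nat.cast_nonneg (α := ℝ) j]
  have h0 : 0 ≤ Real.logb m (j + 1 : ℕ) := Real.logb_nonneg (by linarith) h1
  have hle : Real.logb m (j + 1 : ℕ) ≤ Real.logb 2 (j + 1 : ℕ) :=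
    div_le_div_of_nonneg_left (Real.log_nonneg h1) (Real.log_pos (by norm_num))
      (Real.log_le_log (by norm_num) hm)
  refine le_trans ?_ hle
  have h2 := Nat.ceil_lt_add_one h0
  rcases Nat.eq_zero_or_pos ⌈Real.logb m (j + 1 : ℕ)⌉₊ with hz | hz
  · simp only [lastLevel, hz]
    simpa using h0
  · rw [lastLevel, Nat.cast_sub hz, Nat.cast_one]
    linarith

lemma lastLevel_le (hm : 2 ≤ m) (j : ℕ) : lastLevel m j ≤ j := by
  have h : Real.logb 2 (j + 1 : ℕ) ≤ j := by
    rw [Real.logb_le_iff_le_rpow (by norm_num) (by positivity), Real.rpow_natCast]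
    exact_mod_cast Nat.lt_two_pow_self
  exact_mod_cast (lastLevel_le_logb hm j).trans h

lemma two_mul_lastLevel_add_one_le (hm : 2 ≤ m) (j : ℕ) :
    ((2 * lastLevel m j + 1 : ℕ) : ℝ≥0∞) ≤
      ENNReal.ofReal (max 1 (2 * (⌈Real.logb m (j + 1 : ℕ)⌉ : ℝ) - 1)) := by
  have h0 : 0 ≤ Real.logb m (j + 1 : ℕ) := Real.logb_nonneg (by linarith) (by simp)
  rw [← ENNReal.ofReal_natCast]
  refine ENNReal.ofReal_le_ofReal ?_
  rw [← natCast_ceil_eq_intCast_ceil h0, lastLevel]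
  rcases Nat.eq_zero_or_pos ⌈Real.logb m (j + 1 : ℕ)⌉₊ with hz | hz
  · rw [hz]
    exact le_max_of_le_left (by simp)
  · refine le_max_of_le_right (le_of_eq ?_)
    rw [Nat.cast_add, Nat.cast_mul, Nat.cast_sub hz]
    push_cast
    ring

/-- The sets `S l` forced into the levels contribute at most `2 m` to the expected size of the
lowest level, since the sampling probability is `1 / (2 m)` and not `1 / m`. -/
lemma sum_forced_le (hm : 2 ≤ m) (T : ℕ) {a : ℝ} {s : ℕ → ℝ} (ha : a ≤ m ^ (T + 1))
    (hs : ∀ l, s l ≤ m ^ (l + 1)) :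
    (1 / (2 * m)) ^ T * a + ∑ l ∈ range T, (1 / (2 * m)) ^ l * s l ≤ 2 * m := by
  have key : ∀ l b, b ≤ m ^ (l + 1) → (1 / (2 * m)) ^ l * b ≤ m * (1 / 2) ^ l := by
    intro l b hb
    calc (1 / (2 * m)) ^ l * b ≤ (1 / (2 * m)) ^ l * m ^ (l + 1) := by gcongr
      _ = m * (1 / 2) ^ l := by
        rw [pow_succ, ← mul_assoc, ← mul_pow, mul_comm]
        congr 2
        field_simp
  have hsum : ∑ l ∈ range T, m * (1 / 2 : ℝ) ^ l = m * (2 - 2 * (1 / 2) ^ T) := by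
    rw [← Finset.mul_sum, geom_sum_eq (by norm_num)]
    ring
  have h1 := key T a ha
  have h2 := Finset.sum_le_sum fun l (_ : l ∈ range T) => key l (s l) (hs l)
  have h3 : 0 ≤ m * (1 / 2 : ℝ) ^ T := by positivity
  rw [hsum] at h2
  linarith

/-- A bound for the exponential moment gives a bound for the total bunch size. -/
lemma le_of_pow_le (hm : 2 ≤ m) (j N : ℕ)
    (h : (1 + 1 / (2 * m) / 2) ^ N ≤ 4 * ((j : ℝ) + 1) ^ 2 * 2 ^ lastLevel m j) :
    (N : ℝ) ≤ 20 * m * max 1 (Real.logb 2 (j + 1 : ℕ)) := by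
  set lam := Real.logb 2 (j + 1 : ℕ) with hlam
  set q : ℝ := 1 / (2 * m) / 2 with hq
  have hm0 : 0 < m := by linarith
  have hq0 : 0 ≤ q := by positivity
  have hq1 : q ≤ 1 := by rw [hq, div_div, div_le_one (by positivity)]; linarith
  -- Bernoulli's inequality, with exponent `q ≤ 1`
  have hbern : (2 : ℝ) ^ q ≤ 1 + q := by
    have := rpow_one_add_le_one_add_mul_self (s := 1) (by norm_num) hq0 hq1
    norm_num at this
    exact this
  have hj : (j : ℝ) + 1 = 2 ^ lam := by
    rw [hlam, Real.rpow_logb (by norm_num) (by norm_num) (by positivity)]; push_cast; rfl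
  have hpow : (2 : ℝ) ^ (q * N) ≤ 2 ^ (2 + 2 * lam + lastLevel m j) := by
    calc (2 : ℝ) ^ (q * N) = (2 ^ q) ^ N := by rw [Real.rpow_mul (by norm_num), Real.rpow_natCast]
      _ ≤ (1 + q) ^ N := by gcongr
      _ ≤ _ := h
      _ = _ := by
        rw [Real.rpow_add (by norm_num), Real.rpow_add (by norm_num), Real.rpow_natCast, hj,
          mul_comm 2 lam, Real.rpow_mul (by norm_num)]
        norm_num
  rw [Real.rpow_le_rpow_left_iff (by norm_num)] at hpow
  have hκ := lastLevel_le_logb hm j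
  have h5 : q * N ≤ 5 * max 1 lam := by
    have := le_max_left 1 lam
    have := le_max_right 1 lam
    linarith
  have : (N : ℝ) = 4 * m * (q * N) := by rw [hq]; field_simp; norm_num
  rw [this]
  have := mul_le_mul_of_nonneg_left h5 (show 0 ≤ 4 * m by positivity)
  linarith

lemma prod_bunchFactor_eq {ι : Type*} (d : ι → ι → ℝ≥0∞) (p : ℝ) (F : ℕ → Finset ι) (v : ι)
    {k T : ℕ} (hk : k ≤ T) :
    ∏ l ∈ range T, bunchFactor d p (l < k) (F (l + 1)) (F l) v =
      (1 + p / 2) ^ (∑ l ∈ range k, #(bunch d (F (l + 1)) (F l) v)) / 2 ^ k := by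
  rw [← Finset.prod_subset (Finset.range_mono hk)]
  · rw [← Finset.prod_pow_eq_pow_sum, ← Finset.card_range k, ← Finset.prod_const,
      Finset.card_range, ← Finset.prod_div_distrib]
    exact Finset.prod_congr rfl fun l hl => by rw [bunchFactor, if_pos (Finset.mem_range.1 hl)]
  · intro l _ hl
    rw [bunchFactor, if_neg (by simpa using hl)]

/-- Hierarchy with bunches of the right size for every rank. -/
lemma exists_small_hierarchy {n : ℕ} (d : Fin n → Fin n → ℝ≥0∞) (hm : 2 ≤ m) :
    ∃ F : ℕ → Finset (Fin n),
      (∀ l < n, ∀ j : Fin n, (j : ℝ) + 1 ≤ m ^ (l + 1) → j ∈ F l) ∧ (#(F 0) : ℝ) ≤ 4 * m ∧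
      ∀ j : Fin n, ((∑ l ∈ range (lastLevel m j), #(bunch d (F (l + 1)) (F l) j) : ℕ) : ℝ) ≤
        20 * m * max 1 (Real.logb 2 (j + 1 : ℕ)) := by
  classical
  have hm0 : 0 < m := by linarith
  set p : ℝ := 1 / (2 * m) with hp
  have hp0 : 0 ≤ p := by positivity
  have hp1 : p ≤ 1 := by rw [hp, div_le_one (by positivity)]; linarith
  let S : ℕ → Finset (Fin n) := fun l => univ.filter fun j => (j : ℝ) + 1 ≤ m ^ (l + 1)
  have hS : ∀ l, (#(S l) : ℝ) ≤ m ^ (l + 1) := by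
    intro l
    have h : #(S l) ≤ #(range ⌊m ^ (l + 1)⌋₊) := by
      refine Finset.card_le_card_of_injOn Fin.val (fun j hj => ?_) Fin.val_injective.injOn
      have hj : (j : ℝ) + 1 ≤ m ^ (l + 1) := by simpa [S] using hj
      simp only [Finset.coe_range, Set.mem_Iio]
      exact Nat.le_floor (by push_cast; exact hj)
    rw [Finset.card_range] at h
    exact (Nat.cast_le.2 h).trans (Nat.floor_le (by positivity))
  have hn : (n : ℝ) ≤ m ^ (n + 1) := by
    calc (n : ℝ) ≤ (2 : ℝ) ^ n := by exact_mod_cast Nat.lt_two_pow_self.le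
      _ ≤ m ^ n := by gcongr
      _ ≤ m ^ (n + 1) := pow_le_pow_right₀ (by linarith) (by omega)
  -- The summable weights `1 / rank ^ 2` replace a union bound over the vertices, and `c = 1 / m`
  -- makes the bound for the lowest level a constant. With `n` levels below the full set, no
  -- vertex uses the top one, since `lastLevel m j ≤ j < n`.
  obtain ⟨F, -, hSF, hF⟩ := exists_hierarchy d hp0 hp1 (fun j : Fin n => lastLevel m j) S
    (c := 1 / m) (by positivity) n univ (fun j => 1 / ((j : ℝ) + 1) ^ 2) (fun j => by positivity)
  have htotal : ∑ j : Fin n, 1 / ((j : ℝ) + 1) ^ 2 * ∏ l ∈ range n,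
      bunchFactor d p (l < lastLevel m j) (F (l + 1)) (F l) j + 1 / m * #(F 0) ≤ 4 := by
    have h1 := sum_forced_le hm n (a := #(univ : Finset (Fin n))) (s := fun l => #(S l))
      (by simpa using hn) hS
    have h2 := mul_le_mul_of_nonneg_left h1 (show 0 ≤ 1 / m by positivity)
    have h3 : 1 / m * (2 * m) = 2 := by field_simp
    have h4 := sum_one_div_succ_sq_le n
    linarith
  have hterm : ∀ j : Fin n, 0 ≤ 1 / ((j : ℝ) + 1) ^ 2 * ∏ l ∈ range n,
      bunchFactor d p (l < lastLevel m j) (F (l + 1)) (F l) j := fun j =>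
    mul_nonneg (by positivity) (Finset.prod_nonneg fun l _ => bunchFactor_nonneg d hp0 _ _ _ _)
  refine ⟨F, fun l hl j hj => hSF l hl (by simpa [S] using hj), ?_, fun j => ?_⟩
  · have h1 : 1 / m * #(F 0) ≤ 4 := by
      linarith [Finset.sum_nonneg fun j (_ : j ∈ univ) => hterm j]
    rwa [one_div_mul_eq_div, div_le_iff₀ hm0] at h1
  · refine le_of_pow_le hm j _ ?_
    have h1 := Finset.single_le_sum (fun j _ => hterm j) (Finset.mem_univ j)
    have h2 : 0 ≤ 1 / m * (#(F 0) : ℝ) := by positivity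
    rw [prod_bunchFactor_eq d p F j ((lastLevel_le hm j).trans j.2.le)] at h1
    have h3 := h1.trans ((le_add_of_nonneg_right h2).trans htotal)
    rw [div_mul_div_comm, one_mul, div_le_iff₀ (by positivity)] at h3
    linarith

/-- Existence of hub sets with prioritized stretch and prioritized size, in any finite (extended
pseudo)metric on the ranks `0, …, n - 1`. -/
lemma exists_hubs {n : ℕ} (d : Fin n → Fin n → ℝ≥0∞) (hself : ∀ a, d a a = 0)
    (hsymm : ∀ a b, d a b = d b a) (htri : ∀ a b c, d a c ≤ d a b + d b c) (hm : 2 ≤ m) :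
    ∃ H : Fin n → Finset (Fin n),
      (∀ j i : Fin n, j < i → ∃ h ∈ H j, h ∈ H i ∧ d j h + d h i ≤
        ENNReal.ofReal (max 1 (2 * (⌈Real.logb m (j + 1 : ℕ)⌉ : ℝ) - 1)) * d j i) ∧
      ∀ j : Fin n, (#(H j) : ℝ) ≤ 26 * m * max 1 (Real.logb 2 (j + 1 : ℕ)) := by
  obtain ⟨F, hSF, hF0, hF⟩ := exists_small_hierarchy d hm
  have hpiv : ∀ (l : ℕ) (v : Fin n), ∃ b, l < n → b ∈ F l ∧ ∀ b' ∈ F l, d v b ≤ d v b' := by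
    intro l v
    by_cases hl : l < n
    · have hne : (F l).Nonempty := ⟨⟨0, by omega⟩, hSF l hl _ (by
        simpa using one_le_pow₀ (show (1 : ℝ) ≤ m by linarith))⟩
      obtain ⟨b, hb, hmin⟩ := (F l).exists_min_image (d v) hne
      exact ⟨b, fun _ => ⟨hb, hmin⟩⟩
    · exact ⟨v, fun h => absurd h hl⟩
  choose piv hpiv using hpiv
  let H : Fin n → Finset (Fin n) := fun j => insert j (F 0 ∪
    (range (lastLevel m j)).biUnion fun l => insert (piv l j) (bunch d (F (l + 1)) (F l) j))
  have hmem : ∀ y b, b ∈ H y ↔ b = y ∨ b ∈ F 0 ∨ ∃ k < lastLevel m y,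
      b = piv k y ∨ b ∈ bunch d (F (k + 1)) (F k) y := by
    intro y b
    simp only [H, Finset.mem_insert, Finset.mem_union, Finset.mem_biUnion, Finset.mem_range]
  refine ⟨H, fun j i hji => ?_, fun j => ?_⟩
  · have hle : ∀ y ∈ ({j, i} : Set (Fin n)), lastLevel m j ≤ lastLevel m y := by
      rintro y (rfl | rfl)
      · exact le_rfl
      · exact lastLevel_mono hm (Fin.lt_def.1 hji).le
    have hjn := (lastLevel_le hm j).trans_lt j.2
    have hH : ∀ y ∈ ({j, i} : Set (Fin n)), F 0 ⊆ H y ∧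
        (∀ k < lastLevel m j, bunch d (F (k + 1)) (F k) y ⊆ H y) ∧
        ∀ k < lastLevel m j, ∃ b ∈ F k, b ∈ H y ∧ ∀ b' ∈ F k, d y b ≤ d y b' := by
      refine fun y hy => ⟨fun b hb => ?_, fun k hk b hb => ?_, fun k hk => ?_⟩
      · exact (hmem y b).2 (Or.inr (Or.inl hb))
      · exact (hmem y b).2 (Or.inr (Or.inr ⟨k, hk.trans_le (hle y hy), Or.inr hb⟩))
      · obtain ⟨h1, h2⟩ := hpiv k y (hk.trans hjn)
        exact ⟨piv k y, h1,
          (hmem y _).2 (Or.inr (Or.inr ⟨k, hk.trans_le (hle y hy), Or.inl rfl⟩)), h2⟩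
    obtain ⟨h, hhj, hhi, hd⟩ := exists_common_hub d hsymm htri F H (lastLevel m j) 0 j i j hH
      (hSF _ hjn j (succ_le_pow_lastLevel hm j)) ((hmem j j).2 (Or.inl rfl)) (by simp [hself])
    refine ⟨h, hhj, hhi, hd.trans ?_⟩
    rw [add_zero]
    gcongr
    exact two_mul_lastLevel_add_one_le hm j
  · set N := ∑ l ∈ range (lastLevel m j), #(bunch d (F (l + 1)) (F l) j) with hN
    have hcard : #(H j) ≤ #(F 0) + (N + lastLevel m j) + 1 := by
      refine (Finset.card_insert_le _ _).trans (Nat.succ_le_succ ?_)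
      refine (Finset.card_union_le _ _).trans (Nat.add_le_add_left ?_ _)
      refine Finset.card_biUnion_le.trans ((Finset.sum_le_sum fun l _ =>
        Finset.card_insert_le _ _).trans (le_of_eq ?_))
      rw [Finset.sum_add_distrib]
      simp [hN]
    have hcard' : (#(H j) : ℝ) ≤ #(F 0) + ((N : ℝ) + lastLevel m j) + 1 := by exact_mod_cast hcard
    refine hcard'.trans ?_
    have h1 := hF j
    have h2 := lastLevel_le_logb hm j
    set M := max 1 (Real.logb 2 (j + 1 : ℕ))
    have h3 : 1 ≤ M := le_max_left _ _
    have h4 : Real.logb 2 (j + 1 : ℕ) ≤ M := le_max_right _ _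
    nlinarith

end Hubs

/-! ### The labeling -/

/-- Prioritized hub labels with base `m` in place of `n ^ (1 / t)`. -/
lemma exists_labeling {V : Type*} {n : ℕ} (G : SimpleGraph V) (w : Sym2 V → ℝ≥0) (x : Fin n ≃ V)
    {m : ℝ} (hm : 2 ≤ m) :
    ∃ L : V → Label, IsLabeling n G w L ∧
      HasPrioritizedStretch G w x hubDist L
        (fun j => max 1 (2 * (⌈Real.logb m j⌉ : ℝ) - 1)) ∧
      HasPrioritizedLabelSize x L (fun j => 52 * m * max 1 (Real.logb 2 j)) := by
  obtain ⟨H, hstretch, hsize⟩ := exists_hubs (fun a b => graphDist G w (x a) (x b))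
    (fun a => graphDist_self G w _) (fun a b => graphDist_comm G w _ _)
    (fun a b c => graphDist_triangle G w _ _ _) hm
  let hubs : V → List (ℕ × ℝ≥0∞) := fun v =>
    (H (x.symm v)).toList.map fun h : Fin n => ((h : ℕ), graphDist G w v (x h))
  have hdec : ∀ j k r, (k, r) ∈ decodeHubs (encodeHubs (hubs (x j))) ↔
      ∃ h ∈ H j, (h : ℕ) = k ∧ graphDist G w (x j) (x h) = r := by
    intro j k r
    simp [decodeHubs_encodeHubs, hubs]
  have hlower : ∀ j i, graphDist G w (x j) (x i) ≤
      hubDist (encodeHubs (hubs (x j))) (encodeHubs (hubs (x i))) := by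
    intro j i
    refine le_hubDist fun k r₁ r₂ h₁ h₂ => ?_
    obtain ⟨h, -, hk, rfl⟩ := (hdec j k r₁).1 h₁
    obtain ⟨h', -, hk', rfl⟩ := (hdec i k r₂).1 h₂
    obtain rfl : h = h' := Fin.ext (hk.trans hk'.symm)
    rw [graphDist_comm G w (x i)]
    exact graphDist_triangle G w _ _ _
  refine ⟨fun v => encodeHubs (hubs v), fun v a ha => ?_, fun j i hji => ?_, fun j => ?_⟩
  · obtain ⟨e, he, hae⟩ := mem_encodeHubs ha
    obtain ⟨h, -, rfl⟩ := List.mem_map.1 he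
    rcases hae with rfl | rfl
    · exact h.2
    · exact ⟨v, x h, rfl⟩
  · obtain ⟨h, hj, hi, hle⟩ := hstretch j i hji
    have h₁ := (hdec j h _).2 ⟨h, hj, rfl, rfl⟩
    have h₂ := (hdec i h _).2 ⟨h, hi, rfl, rfl⟩
    refine ⟨⟨hlower j i, (hubDist_le h₁ h₂).trans ?_⟩,
      ⟨(graphDist_comm G w _ _).trans_le (hlower i j), (hubDist_le h₂ h₁).trans ?_⟩⟩
    · rw [graphDist_comm G w (x i)]
      exact hle
    · rw [graphDist_comm G w (x i), add_comm]
      exact hle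
  · have h := hsize j
    simp only [length_encodeHubs, hubs, List.length_map, Finset.length_toList,
      Equiv.symm_apply_apply]
    push_cast at h ⊢
    linarith

lemma HasPrioritizedStretch.mono {V : Type*} {n : ℕ} {G : SimpleGraph V} {w : Sym2 V → ℝ≥0}
    {x : Fin n ≃ V} {D : Label → Label → ℝ≥0∞} {L : V → Label} {α β : ℕ → ℝ}
    (h : HasPrioritizedStretch G w x D L α) (hαβ : ∀ j i : Fin n, j < i → α (j + 1) ≤ β (j + 1)) :
    HasPrioritizedStretch G w x D L β := by
  intro j i hji
  have hle := mul_le_mul_left (ENNReal.ofReal_le_ofReal (hαβ j i hji))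
    (graphDist G w (x j) (x i))
  obtain ⟨⟨h1, h2⟩, h3, h4⟩ := h j i hji
  exact ⟨⟨h1, h2.trans hle⟩, h3, h4.trans hle⟩

end PrioritizedLabeling

open PrioritizedLabeling in
theorem theorem7 :
    ∃ (D : PrioritizedLabeling.Label → PrioritizedLabeling.Label → ℝ≥0∞) (C : ℝ),
      (∀ (V : Type u) (n : ℕ) (G : SimpleGraph V) (w : Sym2 V → ℝ≥0) (x : Fin n ≃ V)
          (t : ℝ), 1 ≤ t →
        ∃ L : V → PrioritizedLabeling.Label,
          PrioritizedLabeling.IsLabeling n G w L ∧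
          PrioritizedLabeling.HasPrioritizedStretch G w x D L
            (fun j => max 1 (2 * (⌈t * Real.logb 2 j / Real.logb 2 n⌉ : ℝ) - 1)) ∧
          PrioritizedLabeling.HasPrioritizedLabelSize x L
            (fun j => C * ((n : ℝ) ^ (1 / t) * max 1 (Real.logb 2 j)))) ∧
      (∀ (V : Type u) (n : ℕ) (G : SimpleGraph V) (w : Sym2 V → ℝ≥0) (x : Fin n ≃ V),
        ∃ L : V → PrioritizedLabeling.Label,
          PrioritizedLabeling.IsLabeling n G w L ∧
          PrioritizedLabeling.HasPrioritizedStretch G w x D L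
            (fun j => max 1 (2 * (⌈Real.logb 2 j⌉ : ℝ) - 1)) ∧
          PrioritizedLabeling.HasPrioritizedLabelSize x L
            (fun j => C * max 1 (Real.logb 2 j))) := by
  refine ⟨hubDist, 104, fun V n G w x t ht => ?_, fun V n G w x => ?_⟩
  -- For `t ≥ log₂ n` the base is `2`; the labels are then those for `t = log₂ n`.
  · obtain ⟨L, hL, hstretch, hsize⟩ :=
      exists_labeling G w x (m := max 2 ((n : ℝ) ^ (1 / t))) (le_max_left _ _)
    have ht0 : 0 < t := by linarith
    refine ⟨L, hL, hstretch.mono fun j i hji => ?_, fun j => ?_⟩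
    · have hn : 2 ≤ n := by have := Fin.lt_def.1 hji; omega
      have hn' : (1 : ℝ) < n := by exact_mod_cast hn
      have hj : (1 : ℝ) ≤ (j + 1 : ℕ) := by simp
      have hlogn := Real.log_pos hn'
      have hlog : Real.log n / t ≤ Real.log (max 2 ((n : ℝ) ^ (1 / t))) := by
        rw [← one_div_mul_eq_div, ← Real.log_rpow (by linarith)]
        exact Real.log_le_log (by positivity) (le_max_right _ _)
      have hle : Real.logb (max 2 ((n : ℝ) ^ (1 / t))) (j + 1 : ℕ) ≤
          t * Real.logb 2 (j + 1 : ℕ) / Real.logb 2 n := by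
        calc Real.logb (max 2 ((n : ℝ) ^ (1 / t))) (j + 1 : ℕ)
            ≤ Real.log (j + 1 : ℕ) / (Real.log n / t) :=
              div_le_div_of_nonneg_left (Real.log_nonneg hj) (by positivity) hlog
          _ = t * Real.logb 2 (j + 1 : ℕ) / Real.logb 2 n := by
              have := Real.log_pos one_lt_two
              unfold Real.logb
              field_simp
      have hceil : ((⌈Real.logb (max 2 ((n : ℝ) ^ (1 / t))) (j + 1 : ℕ)⌉ : ℤ) : ℝ) ≤
          (⌈t * Real.logb 2 (j + 1 : ℕ) / Real.logb 2 n⌉ : ℤ) :=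
        Int.cast_le.2 (Int.ceil_mono hle)
      exact max_le_max le_rfl (by linarith)
    · refine (hsize j).trans ?_
      have hn : (1 : ℝ) ≤ n := by exact_mod_cast (Nat.zero_le j).trans_lt j.2
      have h1 : 1 ≤ (n : ℝ) ^ (1 / t) := Real.one_le_rpow hn (by positivity)
      have h2 : max 2 ((n : ℝ) ^ (1 / t)) ≤ 2 * (n : ℝ) ^ (1 / t) :=
        max_le (by linarith) (by linarith)
      have h3 : 0 ≤ max 1 (Real.logb 2 (j + 1 : ℕ)) := zero_le_one.trans (le_max_left _ _)
      have h4 := mul_le_mul_of_nonneg_right h2 h3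
      linarith
  · obtain ⟨L, hL, hstretch, hsize⟩ := exists_labeling G w x (m := 2) le_rfl
    refine ⟨L, hL, hstretch, fun j => (hsize j).trans (le_of_eq ?_)⟩
    norm_num
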